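/- Fix an integer $k\ge 1$. Let $\mathbb E$ be a real Banach space and let $F=(F_{i_1,\dots,i_k})_{(i_1,\dots,i_k)\in\mathbb N^k}$ be an array of strongly measurable functions $F_{i_1,\dots,i_k}:\mathbb R^k\to\mathbb E$ such that $F_{i_1,\dots,i_k}=0$ whenever two of the indices coincide, and $F_{i_1,\dots,i_k}=0$ for all but finitely many $(i_1,\dots,i_k)$. Put $$\hat F_{i_1,\dots,i_k}(x_1,\dots,x_k)=\frac1{k!}\sum_{\sigma}F_{i_{\sigma(1)},\dots,i_{\sigma(k)}}(x_{\sigma(1)},\dots,x_{\sigma(k)}),$$ the sum being over all permutations $\sigma$ of $\{1,\dots,k\}$. For a sequence $\boldsymbol\xi=(\xi_i)$ and a matrix $\mathbb X=[\boldsymbol\xi_1,\dots,\boldsymbol\xi_k]$, $\boldsymbol\xi_j=(\xi_{ji})_i$, of real random variables on a probability space put $$\hat F(\boldsymbol\xi^k)=\sum_{i_1,\dots,i_k}\hat F_{i_1,\dots,i_k}(\xi_{i_1},\dots,\xi_{i_k}),\qquad \hat F(\mathbb X)=\sum_{i_1,\dots,i_k}\hat F_{i_1,\dots,i_k}(\xi_{1i_1},\dots,\xi_{ki_k}),$$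 and let $\xi=\|\hat F(\boldsymbol\xi^k)\|$, $\eta=\|\hat F(\mathbb X)\|$. Let $p>1$ and $c>0$. Then there is a constant $C>0$, depending only on $k$, $p$ and $c$, such that for every non-decreasing $W:[0,\infty)\to[0,\infty)$ with $W(st)\le c\,s^p\,W(t)$ for all $0<s<1$ and $t>0$, and for all $\mathbb E$, $F$, $\boldsymbol\xi$, $\mathbb X$ as above, the following hold (the upper limits being taken in $[0,\infty]$). (A) If $\boldsymbol\xi$ is a sequence of independent random variables and $\boldsymbol\xi_1,\dots,\boldsymbol\xi_k$ are mutually independent sequences, each with the same law as $\boldsymbol\xi$, then $$\limsup_{t\to\infty}W(t)\,\mathsf P(\xi\ge t)\le\limsup_{t\to\infty}W(t)\,\mathsf P(\eta\ge Ct).$$ (B) If the sequences $\boldsymbol\xi_1,\dots,\boldsymbol\xi_k$ are interchangeable (their joint law is invariant under permutations of the $k$ sequences; in particular, if they are as in (A)), the columns $(\xi_{1i},\dots,\xi_{ki})$, $i\in\mathbb N$, are independent, and $\boldsymbol\xi$ has the same law as each $\boldsymbol\xi_j$, then $$\limsup_{t\to\infty}W(t)\,\mathsf P(\eta\ge t)\le\limsup_{t\to\infty}W(t)\,\mathsf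 P(\xi\ge Ct).$$ -/

import Mathlib

open MeasureTheory ProbabilityTheory Filter
open scoped NNReal ENNReal

noncomputable section

namespace UStatDecoupling

/-- A finitely supported, diagonal-free array of strongly measurable functions
`F_{i₁,…,i_k} : ℝ^k → E`. -/
structure IsUKernel {k : ℕ} {E : Type*} [NormedAddCommGroup E]
    (F : (Fin k → ℕ) → (Fin k → ℝ) → E) : Prop where
  stronglyMeasurable : ∀ i, StronglyMeasurable (F i)
  diagonalFree : ∀ i, (∃ a b, a ≠ b ∧ i a = i b) → F i = 0
  finiteSupport : {i | F i ≠ 0}.Finite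

/-- The symmetrized array
`F̂_{i₁,…,i_k}(x₁,…,x_k) = (1/k!) ∑_σ F_{i_{σ1},…,i_{σk}}(x_{σ1},…,x_{σk})`. -/
def symmetrize {k : ℕ} {E : Type*} [NormedAddCommGroup E] [NormedSpace ℝ E]
    (F : (Fin k → ℕ) → (Fin k → ℝ) → E) : (Fin k → ℕ) → (Fin k → ℝ) → E :=
  fun i x => ((k.factorial : ℝ)⁻¹) • ∑ σ : Equiv.Perm (Fin k), F (i ∘ σ) (x ∘ σ)

/-- The U-statistic `∑_{i₁,…,i_k} F_{i₁,…,i_k}(ξ_{1 i₁},…,ξ_{k i_k})`, for `k` random sequences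
`X 0, …, X (k-1)`. The sum runs over all multi-indices; for the arrays of `IsUKernel` (and their
symmetrizations) only finitely many terms are non-zero. -/
def uStat {k : ℕ} {E : Type*} [NormedAddCommGroup E] {Ω : Type*}
    (F : (Fin k → ℕ) → (Fin k → ℝ) → E) (X : Fin k → ℕ → Ω → ℝ) (ω : Ω) : E :=
  ∑ᶠ i : Fin k → ℕ, F i (fun j => X j (i j) ω)

/-- `ξ` is a sequence of independent real random variables (not necessarily identically
distributed) and the rows `X 0, …, X (k-1)` are mutually independent copies of `ξ`. The joint law
of `ξ` and `X` is not restricted. -/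
structure AreIndepCopies {k : ℕ} {Ω : Type*} [MeasurableSpace Ω] (P : Measure Ω)
    (ξ : ℕ → Ω → ℝ) (X : Fin k → ℕ → Ω → ℝ) : Prop where
  measurable_seq : ∀ i, Measurable (ξ i)
  measurable_rows : ∀ j i, Measurable (X j i)
  indep_seq : iIndepFun ξ P
  indep_rows : iIndepFun (fun q : Fin k × ℕ => X q.1 q.2) P
  identDistrib : ∀ j, IdentDistrib (fun ω i => X j i ω) (fun ω i => ξ i ω) P P

/-- The rows `X 0, …, X (k-1)` are interchangeable (every permutation of them has the same joint
law), the columns `(X 0 i, …, X (k-1) i)`, `i ∈ ℕ`, are independent, and `ξ` has the law of each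
row. -/
structure AreInterchangeable {k : ℕ} {Ω : Type*} [MeasurableSpace Ω] (P : Measure Ω)
    (ξ : ℕ → Ω → ℝ) (X : Fin k → ℕ → Ω → ℝ) : Prop where
  measurable_seq : ∀ i, Measurable (ξ i)
  measurable_rows : ∀ j i, Measurable (X j i)
  indep_columns : iIndepFun (fun (i : ℕ) (ω : Ω) (j : Fin k) => X j i ω) P
  interchangeable : ∀ π : Equiv.Perm (Fin k),
    IdentDistrib (fun ω j i => X (π j) i ω) (fun ω j i => X j i ω) P P
  identDistrib : ∀ j, IdentDistrib (fun ω i => X j i ω) (fun ω i => ξ i ω) P P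

/-- `limsup_{t → ∞} W(t) P(‖Z‖ ≥ a t)`, as an element of `[0, ∞]`. -/
def limsupTail {Ω : Type*} [MeasurableSpace Ω] (P : Measure Ω) {E : Type*} [NormedAddCommGroup E]
    (W : ℝ≥0 → ℝ≥0) (Z : Ω → E) (a : ℝ≥0) : ℝ≥0∞ :=
  limsup (fun t : ℝ≥0 => (W t : ℝ≥0∞) * P {ω | ((a * t : ℝ≥0) : ℝ) ≤ ‖Z ω‖}) atTop

end UStatDecoupling

end

namespace UStatDecoupling

/-! Decoupling here rests on pointwise inequalities. One U-statistic is bounded by a positive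
combination of others, with total weight at most a constant independent of the number of columns,
where each of the others has the law of the statistic to be compared with. Such bounds come from
averaging over a random choice made independently in each column. The kernel vanishes unless the
indices are distinct, so within each summand the choices act independently, and the average is a
combination of few U-statistics (`sum_prod_smul_multiSum`). For (A), replacing each entry of a
column by that of `z` with probability `t`, at most one per column, gives a polynomial in `t` of
degree at most `k`. Its value at `t = 1` is the one-row statistic, recovered by extrapolation from
`[0, 1/k]` (`norm_multiSum_const_le`). For (B), inclusion-exclusion over the sets of rows to choose
from isolates the permutations (`norm_multiSum_le_const`). A dominated variable then has a
dyadically summed tail bound (`measure_le_of_le_sum`). Since `p > 1`, the growth of `W` makes the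
series converge, and rescaling `t` absorbs its sum (`exists_limsup_le`). -/

/-- The sum `∑ i, H i (x_1(i_1), …, x_k(i_k))` over all multi-indices in a finite set. -/
def multiSum {k : ℕ} {ι E : Type*} [Fintype ι] [AddCommMonoid E]
    (H : (Fin k → ι) → (Fin k → ℝ) → E) (x : Fin k → ι → ℝ) : E :=
  ∑ i : Fin k → ι, H i (fun a => x a (i a))

/-! ### Averaging over independent choices in the columns -/

section Averaging

variable {k : ℕ} {ι B D E : Type*} [Fintype ι] [DecidableEq ι] [Fintype B]
  [Fintype D] [DecidableEq D] [AddCommGroup E] [Module ℝ E]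

theorem sum_prod_eq_one {w : B → ℝ} (hw : ∑ β, w β = 1) :
    ∑ b : ι → B, ∏ c, w (b c) = 1 := by
  rw [← Fintype.prod_sum (fun _ : ι => w)]
  simp [hw]

/-- Under a product weight, the values at distinct indices are independent. -/
theorem sum_prod_smul_comp {κ : Type*} [Fintype κ] [DecidableEq κ] {w : B → ℝ}
    (hw : ∑ β, w β = 1) {i : κ → ι} (hi : Function.Injective i) (π : κ → B → D)
    (g : (κ → D) → E) :
    ∑ b : ι → B, (∏ c, w (b c)) • g (fun a => π a (b (i a))) =
      ∑ γ : κ → D, (∏ a, ∑ β, if π a β = γ a then w β else 0) • g γ := by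
  have h1 : ∀ b : ι → B, (∏ c, w (b c)) • g (fun a => π a (b (i a))) =
      ∑ γ : κ → D, ((∏ c, w (b c)) * ∏ a, if π a (b (i a)) = γ a then (1 : ℝ) else 0) • g γ := by
    intro b
    rw [Finset.sum_eq_single (fun a => π a (b (i a)))]
    · simp
    · intro γ _ hγ
      obtain ⟨a, ha⟩ := Function.ne_iff.1 hγ
      rw [Finset.prod_eq_zero (Finset.mem_univ a) (if_neg (Ne.symm ha))]
      simp
    · simp
  simp_rw [h1]
  rw [Finset.sum_comm]
  refine Finset.sum_congr rfl fun γ _ => ?_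
  rw [← Finset.sum_smul]
  congr 1
  have h2 : ∀ b : ι → B, (∏ c, w (b c)) * (∏ a, if π a (b (i a)) = γ a then (1 : ℝ) else 0) =
      ∏ c, (w (b c) * ∏ a with i a = c, if π a (b c) = γ a then (1 : ℝ) else 0) := by
    intro b
    rw [Finset.prod_mul_distrib, ← Finset.prod_fiberwise Finset.univ i]
    congr 1
    refine Finset.prod_congr rfl fun c _ => Finset.prod_congr rfl fun a ha => ?_
    rw [(Finset.mem_filter.1 ha).2]
  simp_rw [h2]
  rw [← Fintype.prod_sum (fun c β => w β * ∏ a with i a = c, if π a β = γ a then (1 : ℝ) else 0)]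
  symm
  -- A column missed by `i` contributes total mass one; by injectivity any other column carries
  -- exactly one constraint.
  refine Fintype.prod_of_injective i hi _ _ (fun c hc => ?_) (fun a => ?_)
  · have : (Finset.univ.filter fun a => i a = c) = ∅ := by
      ext a; simpa using fun h => hc ⟨a, h⟩
    simp [this, hw]
  · have : (Finset.univ.filter fun a' => i a' = i a) = {a} := by
      ext a'; simp [hi.eq_iff]
    simp [this]

/-- One choice `b c` serves all `k` rows, yet only its marginals `π a (b c)` survive: a nonzero
summand never uses a column twice. -/
theorem sum_prod_smul_multiSum {w : B → ℝ} (hw : ∑ β, w β = 1) (π : Fin k → B → D)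
    {H : (Fin k → ι) → (Fin k → ℝ) → E} (hH : ∀ i, ¬ Function.Injective i → H i = 0)
    (y : Fin k → D → ι → ℝ) :
    ∑ b : ι → B, (∏ c, w (b c)) • multiSum H (fun a c => y a (π a (b c)) c) =
      ∑ γ : Fin k → D, (∏ a, ∑ β, if π a β = γ a then w β else 0) •
        multiSum H (fun a => y a (γ a)) := by
  simp only [multiSum, Finset.smul_sum]
  rw [Finset.sum_comm, Finset.sum_comm (s := Finset.univ (α := Fin k → D))]
  refine Finset.sum_congr rfl fun i _ => ?_
  by_cases hi : Function.Injective i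
  · exact sum_prod_smul_comp hw hi π (fun γ => H i (fun a => y a (γ a) (i a)))
  · simp [hH i hi]

end Averaging

/-! ### Pointwise decoupling inequalities -/

/-- Extrapolation of polynomials of degree at most `k` from `[0, 1/k]` to `1`. -/
theorem exists_extrapolation (k : ℕ) (hk : 1 ≤ k) :
    ∃ (lam v : Fin (k + 1) → ℝ), (∀ l, 0 ≤ v l) ∧ (∀ l, k * v l ≤ 1) ∧
      ∀ q : Polynomial ℝ, q.natDegree ≤ k → ∑ l, lam l * q.eval (v l) = q.eval 1 := by
  have hk0 : (0 : ℝ) < k := by exact_mod_cast hk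
  set v : Fin (k + 1) → ℝ := fun l => (l : ℕ) / (k : ℝ) ^ 2 with hv
  refine ⟨fun l => (Lagrange.basis Finset.univ v l).eval 1, v, fun l => by positivity, fun l => ?_,
    fun q hq => ?_⟩
  · have : ((l : ℕ) : ℝ) ≤ k := by exact_mod_cast Nat.lt_succ_iff.1 l.2
    simp only [hv]
    rw [← mul_div_assoc, div_le_one (by positivity), sq]
    gcongr
  · have hinj : Set.InjOn v (Finset.univ : Finset (Fin (k + 1))) := by
      intro a _ b _ hab
      have : ((a : ℕ) : ℝ) = (b : ℕ) := by
        simpa [hv, div_left_inj' (pow_ne_zero 2 hk0.ne')] using hab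
      exact Fin.ext (by exact_mod_cast this)
    have hdeg : q.degree < (Finset.univ : Finset (Fin (k + 1))).card := by
      simpa using lt_of_le_of_lt Polynomial.degree_le_natDegree
        (by exact_mod_cast Nat.lt_succ_iff.2 hq)
    conv_rhs => rw [Lagrange.eq_interpolate hinj hdeg, Lagrange.interpolate_apply]
    simp [Polynomial.eval_finsetSum, mul_comm]

/-- The U-statistic of a single row `z` is dominated by a weighted sum of the U-statistics of the
`k` rows obtained from `x` by replacing at most one entry per column by that of `z`. -/
theorem norm_multiSum_const_le (k : ℕ) (hk : 1 ≤ k) :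
    ∃ C : ℝ, ∀ (ι : Type) [Fintype ι] [DecidableEq ι], ∃ a : (ι → Option (Fin k)) → ℝ,
      (∀ b, 0 ≤ a b) ∧ ∑ b, a b ≤ C ∧
      ∀ (E : Type*) [NormedAddCommGroup E] [NormedSpace ℝ E]
        (H : (Fin k → ι) → (Fin k → ℝ) → E), (∀ i, ¬ Function.Injective i → H i = 0) →
      ∀ (x : Fin k → ι → ℝ) (z : ι → ℝ), ‖multiSum H (fun _ => z)‖ ≤
        ∑ b, a b * ‖multiSum H (fun j c => if b c = some j then z c else x j c)‖ := by
  obtain ⟨lam, v, hv0, hv1, hq⟩ := exists_extrapolation k hk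
  -- The replaced row: each with weight `t`, none with weight `1 - k * t`, which is nonnegative only
  -- for `t ≤ 1/k`.
  set w : ℝ → Option (Fin k) → ℝ := fun t β => β.elim (1 - k * t) (fun _ => t) with hw
  have hw1 : ∀ t, ∑ β, w t β = 1 := by intro t; simp [hw, Fintype.sum_option]
  have hw0 : ∀ l β, 0 ≤ w (v l) β := by
    rintro l (_ | β)
    · simpa [hw] using hv1 l
    · simpa [hw] using hv0 l
  refine ⟨∑ l, |lam l|, fun ι _ _ => ⟨fun b => ∑ l, |lam l| * ∏ c, w (v l) (b c),
    fun b => Finset.sum_nonneg fun l _ => mul_nonneg (abs_nonneg _)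
      (Finset.prod_nonneg fun c _ => hw0 l _), ?_, ?_⟩⟩
  · rw [Finset.sum_comm]
    simp_rw [← Finset.mul_sum, sum_prod_eq_one (hw1 _)]
    simp
  intro E _ _ H hH x z
  set y : Fin k → Bool → ι → ℝ := fun j d => if d then z else x j with hy
  set π : Fin k → Option (Fin k) → Bool := fun j β => decide (β = some j) with hπ
  have hmarg : ∀ t (j : Fin k) d, (∑ β, if π j β = d then w t β else 0) =
      if d then t else 1 - t := by
    intro t j d
    have htrue : (∑ β, if π j β = true then w t β else 0) = t := by
      simp [hπ, hw]
    cases d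
    · have := hw1 t
      rw [← Finset.sum_filter_add_sum_filter_not _ (fun β => π j β = true),
        Finset.sum_filter, htrue] at this
      simp only [Bool.not_eq_true, Finset.sum_filter] at this
      simp only [Bool.false_eq_true, if_false]
      linarith
    · simpa using htrue
  have key : ∀ t, ∑ b : ι → Option (Fin k), (∏ c, w t (b c)) •
      multiSum H (fun j c => if b c = some j then z c else x j c) =
      ∑ γ : Fin k → Bool, (∏ j, if γ j then t else 1 - t) •
        multiSum H (fun j => y j (γ j)) := by
    intro t
    have := sum_prod_smul_multiSum (hw1 t) π hH y
    simp only [hmarg] at this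
    rw [← this]
    refine Finset.sum_congr rfl fun b _ => ?_
    congr 2
    funext j c
    by_cases h : b c = some j <;> simp [hy, hπ, h]
  have hone : ∑ γ : Fin k → Bool, (∏ j, if γ j then (1 : ℝ) else 1 - 1) •
      multiSum H (fun j => y j (γ j)) = multiSum H (fun _ => z) := by
    rw [Finset.sum_eq_single (fun _ => true)]
    · simp [hy]
    · intro γ _ hγ
      obtain ⟨j, hj⟩ := Function.ne_iff.1 hγ
      rw [Finset.prod_eq_zero (Finset.mem_univ j) (by simp [Bool.eq_false_of_not_eq_true hj])]
      simp
    · simp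
  have hpoly : ∀ γ : Fin k → Bool, ∑ l, lam l * ∏ j, (if γ j then v l else 1 - v l) =
      ∏ j, if γ j then (1 : ℝ) else 1 - 1 := by
    intro γ
    have := hq (∏ j, if γ j then Polynomial.X else 1 - Polynomial.X) (by
      refine (Polynomial.natDegree_prod_le _ _).trans ?_
      refine (Finset.sum_le_sum (g := fun _ => 1) fun j _ => ?_).trans (by simp)
      split_ifs
      · exact Polynomial.natDegree_X_le
      · exact (Polynomial.natDegree_sub_le _ _).trans (by simp))
    simpa [Polynomial.eval_prod, apply_ite] using this
  have hrep : multiSum H (fun _ => z) = ∑ l, lam l • ∑ b : ι → Option (Fin k),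
      (∏ c, w (v l) (b c)) • multiSum H (fun j c => if b c = some j then z c else x j c) := by
    simp_rw [key, ← hone, ← hpoly, Finset.smul_sum, Finset.sum_smul, smul_smul]
    exact Finset.sum_comm
  rw [hrep]
  simp_rw [Finset.sum_mul]
  rw [Finset.sum_comm]
  refine (norm_sum_le _ _).trans (Finset.sum_le_sum fun l _ => ?_)
  rw [norm_smul, Real.norm_eq_abs]
  simp_rw [mul_assoc]
  rw [← Finset.mul_sum]
  gcongr
  refine (norm_sum_le _ _).trans (Finset.sum_le_sum fun b _ => ?_)
  rw [norm_smul, Real.norm_of_nonneg (Finset.prod_nonneg fun c _ => hw0 l _)]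

/-- Complements turn this into the alternating sum over the subsets of `Tᶜ`. -/
theorem sum_neg_one_pow_card_compl_subset {α : Type*} [Fintype α] [DecidableEq α]
    (T : Finset α) :
    ∑ S : Finset α, (-1 : ℝ) ^ Sᶜ.card * (if T ⊆ S then 1 else 0) =
      if T = Finset.univ then 1 else 0 := by
  have h := Finset.sum_powerset_neg_one_pow_card (x := Tᶜ)
  have h' : ∑ m ∈ Tᶜ.powerset, (-1 : ℝ) ^ m.card = if Tᶜ = ∅ then 1 else 0 := by exact_mod_cast h
  simp only [Finset.compl_eq_empty_iff] at h'
  rw [← h', ← Equiv.sum_comp (Equiv.ofBijective (compl : Finset α → Finset α) compl_bijective)]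
  simp only [Equiv.ofBijective_apply, compl_compl, mul_ite, mul_one, mul_zero]
  rw [← Finset.sum_filter]
  refine Finset.sum_congr ?_ fun _ _ => rfl
  ext S
  simp [Finset.subset_compl_comm]

/-- Polarization: the U-statistic of `k` rows is dominated by a weighted sum of the U-statistics of
single rows, each formed by choosing one entry per column. -/
theorem norm_multiSum_le_const (k : ℕ) (hk : 1 ≤ k) :
    ∃ C : ℝ, ∀ (ι : Type) [Fintype ι] [DecidableEq ι], ∃ a : (ι → Fin k) → ℝ,
      (∀ b, 0 ≤ a b) ∧ ∑ b, a b ≤ C ∧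
      ∀ (E : Type*) [NormedAddCommGroup E] [NormedSpace ℝ E]
        (H : (Fin k → ι) → (Fin k → ℝ) → E), (∀ i, ¬ Function.Injective i → H i = 0) →
      (∀ (σ : Equiv.Perm (Fin k)) i y, H (i ∘ σ) (y ∘ σ) = H i y) →
      ∀ (x : Fin k → ι → ℝ), ‖multiSum H x‖ ≤
        ∑ b, a b * ‖multiSum H (fun _ c => x (b c) c)‖ := by
  have hk0 : k ≠ 0 := by omega
  have hne : (Finset.univ : Finset (Fin k)).Nonempty := ⟨⟨0, hk⟩, Finset.mem_univ _⟩
  -- The value at `∅` only keeps `w` a probability weight; that term has coefficient `0 ^ k = 0`.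
  set R : Finset (Fin k) → Finset (Fin k) := fun S => if S.Nonempty then S else Finset.univ with hR
  have hRne : ∀ S, (R S).Nonempty := by
    intro S; simp only [hR]; split_ifs with h <;> assumption
  set w : Finset (Fin k) → Fin k → ℝ := fun S j => if j ∈ R S then ((R S).card : ℝ)⁻¹ else 0
    with hw
  have hw1 : ∀ S, ∑ β, w S β = 1 := by
    intro S
    have : ((R S).card : ℝ) ≠ 0 := by exact_mod_cast (hRne S).card_pos.ne'
    simp [hw, this]
  have hw0 : ∀ S β, 0 ≤ w S β := by
    intro S β; simp only [hw]; positivity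
  refine ⟨∑ S : Finset (Fin k), (S.card : ℝ) ^ k, fun ι _ _ =>
    ⟨fun b => ∑ S : Finset (Fin k), (S.card : ℝ) ^ k * ∏ c, w S (b c),
    fun b => Finset.sum_nonneg fun S _ => mul_nonneg (by positivity)
      (Finset.prod_nonneg fun c _ => hw0 S _), ?_, ?_⟩⟩
  · rw [Finset.sum_comm]
    simp_rw [← Finset.mul_sum, sum_prod_eq_one (hw1 _)]
    simp
  intro E _ _ H hH hsymm x
  have key : ∀ S, ∑ b : ι → Fin k, (∏ c, w S (b c)) • multiSum H (fun _ c => x (b c) c) =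
      ∑ γ : Fin k → Fin k, (∏ j, w S (γ j)) • multiSum H (fun j => x (γ j)) := by
    intro S
    have := sum_prod_smul_multiSum (hw1 S) (fun _ : Fin k => id) hH (fun _ => x)
    simpa using this
  have hprod : ∀ (S : Finset (Fin k)) (γ : Fin k → Fin k), (S.card : ℝ) ^ k * ∏ j, w S (γ j) =
      if Finset.univ.image γ ⊆ S then 1 else 0 := by
    intro S γ
    rcases S.eq_empty_or_nonempty with rfl | hS
    · simp [hk0, hne.ne_empty]
    · have hRS : R S = S := if_pos hS
      have hc : (S.card : ℝ) ≠ 0 := by exact_mod_cast hS.card_pos.ne'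
      split_ifs with h
      · have : ∀ j, w S (γ j) = (S.card : ℝ)⁻¹ := fun j => by
          simp only [hw, hRS]
          exact if_pos (h (Finset.mem_image_of_mem _ (Finset.mem_univ j)))
        simp [this, hc]
      · obtain ⟨j, hj⟩ : ∃ j, γ j ∉ S := by
          by_contra! h'
          exact h (Finset.image_subset_iff.2 fun j _ => h' j)
        rw [Finset.prod_eq_zero (Finset.mem_univ j) (by simp [hw, hRS, hj]), mul_zero]
  have hperm : ∀ σ : Equiv.Perm (Fin k), multiSum H (fun j => x (σ j)) = multiSum H x := by
    intro σ
    unfold multiSum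
    rw [← Equiv.sum_comp (Equiv.arrowCongr σ.symm (Equiv.refl ι))]
    refine Finset.sum_congr rfl fun i _ => ?_
    rw [← hsymm σ i]
    rfl
  have hsurj : ∑ γ : Fin k → Fin k, (if Finset.univ.image γ = Finset.univ then (1 : ℝ) else 0) •
      multiSum H (fun j => x (γ j)) = (k.factorial : ℝ) • multiSum H x := by
    have hcount : ∑ _σ : Equiv.Perm (Fin k), multiSum H x = (k.factorial : ℝ) • multiSum H x := by
      simp [Fintype.card_perm, Nat.cast_smul_eq_nsmul]
    rw [← hcount]
    symm
    refine Fintype.sum_of_injective (fun σ : Equiv.Perm (Fin k) => (σ : Fin k → Fin k))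
      DFunLike.coe_injective _ _ (fun γ hγ => ?_) (fun σ => ?_)
    · rw [if_neg, zero_smul]
      intro h
      have hs : Function.Surjective γ := fun j => by
        have := h.symm ▸ Finset.mem_univ j
        simpa using this
      exact hγ ⟨Equiv.ofBijective γ ⟨Finite.injective_iff_surjective.2 hs, hs⟩, rfl⟩
    · rw [if_pos (Finset.image_univ_of_surjective σ.surjective), one_smul, hperm]
  -- The factor `|S| ^ k` turns the average into the sum over all maps into `S`; the signs leave the
  -- surjective ones, that is, the permutations.
  have hrep : (k.factorial : ℝ) • multiSum H x = ∑ S : Finset (Fin k),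
      ((-1 : ℝ) ^ Sᶜ.card * (S.card : ℝ) ^ k) • ∑ b : ι → Fin k,
        (∏ c, w S (b c)) • multiSum H (fun _ c => x (b c) c) := by
    simp_rw [key, Finset.smul_sum, smul_smul, mul_assoc, hprod]
    rw [Finset.sum_comm, ← hsurj]
    simp_rw [← Finset.sum_smul, sum_neg_one_pow_card_compl_subset]
  have hfac : ‖multiSum H x‖ ≤ ‖(k.factorial : ℝ) • multiSum H x‖ := by
    rw [norm_smul, Real.norm_natCast]
    exact le_mul_of_one_le_left (norm_nonneg _) (by exact_mod_cast k.factorial_pos)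
  refine hfac.trans ?_
  rw [hrep]
  simp_rw [Finset.sum_mul]
  rw [Finset.sum_comm]
  refine (norm_sum_le _ _).trans (Finset.sum_le_sum fun S _ => ?_)
  rw [norm_smul, norm_mul, norm_pow, norm_neg, norm_one, one_pow, one_mul, norm_pow,
    Real.norm_natCast]
  simp_rw [mul_assoc]
  rw [← Finset.mul_sum]
  gcongr
  refine (norm_sum_le _ _).trans (Finset.sum_le_sum fun b _ => ?_)
  rw [norm_smul, Real.norm_of_nonneg (Finset.prod_nonneg fun c _ => hw0 S _)]

/-! ### From domination to tails and upper limits -/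

theorem ofReal_sub_one_le_tsum (r : ℝ) :
    ENNReal.ofReal (r - 1) ≤ ∑' n : ℕ, (2 : ℝ≥0∞) ^ n * (if (2 : ℝ) ^ n ≤ r then 1 else 0) := by
  rcases lt_or_ge r 1 with hr | hr
  · rw [ENNReal.ofReal_of_nonpos (by linarith)]
    exact zero_le
  obtain ⟨m, hm, hm'⟩ := exists_nat_pow_near hr (one_lt_two (α := ℝ))
  refine le_trans ?_ (ENNReal.sum_le_tsum (Finset.range (m + 1)))
  have hle : ∀ n ∈ Finset.range (m + 1), (2 : ℝ≥0∞) ^ n * (if (2 : ℝ) ^ n ≤ r then 1 else 0) =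
      ENNReal.ofReal (2 ^ n) := by
    intro n hn
    rw [if_pos ((pow_le_pow_right₀ one_le_two (Nat.lt_succ_iff.1 (Finset.mem_range.1 hn))).trans hm),
      mul_one, ENNReal.ofReal_pow zero_le_two, ENNReal.ofReal_ofNat]
  rw [Finset.sum_congr rfl hle, ← ENNReal.ofReal_sum_of_nonneg (fun _ _ => by positivity)]
  refine ENNReal.ofReal_le_ofReal ?_
  rw [geom_sum_eq (by norm_num)]
  norm_num
  linarith

/-- Tail bound for a random variable dominated by a weighted sum of random variables whose tails
are controlled by `τ`. -/
theorem measure_le_of_le_sum {Ω J : Type*} [MeasurableSpace Ω] [Fintype J] {μ : Measure Ω}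
    {C : ℝ} (hC : 0 < C) {a : J → ℝ} (ha : ∀ j, 0 ≤ a j) (haC : ∑ j, a j ≤ C)
    {ζ : Ω → ℝ} {η : J → Ω → ℝ} (hη : ∀ j, Measurable (η j))
    (hζ : ∀ ω, ζ ω ≤ ∑ j, a j * η j ω) {τ : ℝ → ℝ≥0∞}
    (hτ : ∀ j u, μ {ω | u ≤ η j ω} ≤ τ u) {T : ℝ} (hT : 0 < T) :
    μ {ω | T ≤ ζ ω} ≤ ∑' n : ℕ, (2 : ℝ≥0∞) ^ n * τ (2 ^ n * T / (2 * C)) := by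
  set S : J → ℕ → Set Ω := fun j n => {ω | 2 ^ n * T / (2 * C) ≤ η j ω} with hS
  have hSm : ∀ j n, MeasurableSet (S j n) := fun j n => measurableSet_le measurable_const (hη j)
  set f : Ω → ℝ≥0∞ := fun ω =>
    ∑ j, ENNReal.ofReal (a j / C) * ∑' n : ℕ, (2 : ℝ≥0∞) ^ n * (S j n).indicator 1 ω with hf
  have hfm : Measurable f := by
    refine Finset.measurable_sum _ fun j _ => Measurable.const_mul ?_ _
    exact Measurable.tsum fun n => (measurable_one.indicator (hSm j n)).const_mul _
  have hone : ∀ ω, T ≤ ζ ω → 1 ≤ f ω := by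
    intro ω hω
    -- Subtracting `1` removes the levels of `η j` below `T / (2 * C)`; the factor `2` pays for it.
    have hsum : (1 : ℝ) ≤ ∑ j, a j / C * (2 * C * η j ω / T - 1) := by
      have h1 : ∑ j, a j / C * (2 * C * η j ω / T - 1) =
          2 * (∑ j, a j * η j ω) / T - (∑ j, a j) / C := by
        rw [Finset.mul_sum, Finset.sum_div, Finset.sum_div, ← Finset.sum_sub_distrib]
        refine Finset.sum_congr rfl fun j _ => ?_
        field_simp
      have h2 : 2 ≤ 2 * (∑ j, a j * η j ω) / T := by
        rw [le_div_iff₀ hT]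
        linarith [hζ ω]
      have h3 : (∑ j, a j) / C ≤ 1 := (div_le_one hC).2 haC
      rw [h1]
      linarith
    calc (1 : ℝ≥0∞) = ENNReal.ofReal 1 := by simp
      _ ≤ ENNReal.ofReal (∑ j, a j / C * (2 * C * η j ω / T - 1)) := ENNReal.ofReal_le_ofReal hsum
      _ ≤ ∑ j, ENNReal.ofReal (a j / C * (2 * C * η j ω / T - 1)) :=
        Finset.le_sum_of_subadditive _ ENNReal.ofReal_zero.le (fun _ _ => ENNReal.ofReal_add_le) _ _
      _ ≤ f ω := by
        refine Finset.sum_le_sum fun j _ => ?_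
        rw [ENNReal.ofReal_mul (div_nonneg (ha j) hC.le)]
        gcongr
        refine (ofReal_sub_one_le_tsum _).trans (le_of_eq (tsum_congr fun n => ?_))
        have : (2 : ℝ) ^ n ≤ 2 * C * η j ω / T ↔ ω ∈ S j n := by
          simp only [hS, Set.mem_ofPred_eq]
          rw [le_div_iff₀ hT, div_le_iff₀ (by positivity), mul_comm (η j ω)]
        simp [Set.indicator_apply, this]
  calc μ {ω | T ≤ ζ ω} ≤ μ {ω | 1 ≤ f ω} := measure_mono hone
    _ ≤ ∫⁻ ω, f ω ∂μ := by
      simpa using mul_meas_ge_le_lintegral (μ := μ) hfm 1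
    _ = ∑ j, ENNReal.ofReal (a j / C) * ∑' n : ℕ, (2 : ℝ≥0∞) ^ n * μ (S j n) := by
      have hm : ∀ j n, Measurable fun ω => (2 : ℝ≥0∞) ^ n * (S j n).indicator 1 ω :=
        fun j n => (measurable_one.indicator (hSm j n)).const_mul _
      rw [hf, lintegral_finsetSum _ fun j _ => (Measurable.tsum (hm j)).const_mul _]
      refine Finset.sum_congr rfl fun j _ => ?_
      rw [lintegral_const_mul _ (Measurable.tsum (hm j)),
        lintegral_tsum fun n => (hm j n).aemeasurable]
      congr 1
      refine tsum_congr fun n => ?_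
      rw [lintegral_const_mul _ (measurable_one.indicator (hSm j n)),
        lintegral_indicator_one (hSm j n)]
    _ ≤ ∑ j, ENNReal.ofReal (a j / C) * ∑' n : ℕ, (2 : ℝ≥0∞) ^ n * τ (2 ^ n * T / (2 * C)) := by
      gcongr with j _ n
      exact hτ j _
    _ ≤ 1 * ∑' n : ℕ, (2 : ℝ≥0∞) ^ n * τ (2 ^ n * T / (2 * C)) := by
      rw [← Finset.sum_mul]
      gcongr
      rw [← ENNReal.ofReal_sum_of_nonneg fun j _ => div_nonneg (ha j) hC.le, ← Finset.sum_div]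
      exact ENNReal.ofReal_le_one.2 ((div_le_one hC).2 haC)
    _ = _ := one_mul _

/-- The growth condition on `W` turns a summed dyadic tail bound into a comparison of upper limits
with constant one. -/
theorem exists_limsup_le {p : ℝ} (hp : 1 < p) (c : ℝ≥0) {C : ℝ} (hC : 0 < C) :
    ∃ C' : ℝ≥0, 0 < C' ∧ ∀ W : ℝ≥0 → ℝ≥0,
      (∀ s t : ℝ≥0, 0 < s → s < 1 → 0 < t → W (s * t) ≤ c * s ^ p * W t) →
      ∀ σ τ : ℝ → ℝ≥0∞,
      (∀ T : ℝ, 0 < T → σ T ≤ ∑' n : ℕ, (2 : ℝ≥0∞) ^ n * τ (2 ^ n * T / (2 * C))) →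
      limsup (fun t : ℝ≥0 => (W t : ℝ≥0∞) * σ t) atTop ≤
        limsup (fun t : ℝ≥0 => (W t : ℝ≥0∞) * τ ((C' * t : ℝ≥0) : ℝ)) atTop := by
  set r : ℝ≥0 := 2 ^ (1 - p) with hr
  have hr1 : r < 1 := NNReal.rpow_lt_one_of_one_lt_of_neg (by norm_num) (by linarith)
  have hr0 : 0 < 1 - r := tsub_pos_of_lt hr1
  -- `c / (1 - r)` brings the geometric series below one; `2` ensures `s < 1` even for `n = 0`.
  set M : ℝ≥0 := max 2 (c / (1 - r)) with hM
  have hM2 : 2 ≤ M := le_max_left _ _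
  have hM0 : 0 < M := lt_of_lt_of_le (by norm_num) hM2
  have hcM : c * M⁻¹ ≤ 1 - r := by
    rw [← div_eq_mul_inv, div_le_iff₀ hM0, mul_comm, ← div_le_iff₀ hr0]
    exact le_max_right _ _
  lift C to ℝ≥0 using hC.le
  have hC' : 0 < C := by exact_mod_cast hC
  refine ⟨(2 * C * M)⁻¹, by positivity, fun W hW σ τ hστ => ?_⟩
  refine le_of_forall_gt_imp_ge_of_dense fun b hb => ?_
  obtain ⟨t₀, ht₀⟩ := eventually_atTop.1 (eventually_lt_of_limsup_lt hb)
  refine limsup_le_of_le (by isBoundedDefault) (eventually_atTop.2 ⟨max t₀ 1, fun T hT => ?_⟩)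
  have hT0 : 0 < T := lt_of_lt_of_le one_pos ((le_max_right _ _).trans hT)
  have hterm : ∀ n : ℕ, (W T : ℝ≥0∞) * (2 ^ n * τ (2 ^ n * T / (2 * C))) ≤
      ((c * M⁻¹ : ℝ≥0) : ℝ≥0∞) * (r : ℝ≥0∞) ^ n * b := by
    intro n
    have hpow : (1 : ℝ≥0) ≤ 2 ^ n := one_le_pow₀ one_le_two
    set s : ℝ≥0 := (2 ^ n * M)⁻¹ with hs
    set t : ℝ≥0 := 2 ^ n * M * T with ht
    have hst : s * t = T := by
      rw [hs, ht]; field_simp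
    have hs1 : s < 1 := inv_lt_one_of_one_lt₀ (by nlinarith)
    have htT : T ≤ t := le_mul_of_one_le_left hT0.le (by nlinarith)
    have hWT : W T ≤ c * s ^ p * W t := by
      rw [← hst]
      exact hW s t (by positivity) hs1 (by positivity)
    have hτt : (((2 * C * M)⁻¹ * t : ℝ≥0) : ℝ) = 2 ^ n * T / (2 * C) := by
      have : (2 * C * M)⁻¹ * t = 2 ^ n * T / (2 * C) := by
        rw [ht]; field_simp
      rw [this]; push_cast; rfl
    have hb' := ht₀ t ((le_max_left _ _).trans (hT.trans htT))
    rw [hτt] at hb'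
    have hcoef : c * s ^ p * 2 ^ n ≤ c * M⁻¹ * r ^ n := by
      have h1 : s ^ p = (M⁻¹) ^ p * (2 ^ (-p)) ^ n := by
        rw [hs, mul_inv, NNReal.mul_rpow, mul_comm, NNReal.inv_rpow (2 ^ n), NNReal.rpow_neg,
          inv_pow, ← NNReal.rpow_natCast, ← NNReal.rpow_natCast, ← NNReal.rpow_mul,
          ← NNReal.rpow_mul, mul_comm p]
      have h2 : (2 : ℝ≥0) ^ (-p) * 2 = r := by
        rw [hr, sub_eq_add_neg, add_comm, NNReal.rpow_add (by norm_num), NNReal.rpow_one]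
      have h3 : (M⁻¹) ^ p ≤ M⁻¹ := by
        conv_rhs => rw [← NNReal.rpow_one M⁻¹]
        exact NNReal.rpow_le_rpow_of_exponent_ge (by positivity)
          (inv_le_one_of_one_le₀ (one_le_two.trans hM2)) hp.le
      calc c * s ^ p * 2 ^ n = c * (M⁻¹) ^ p * (2 ^ (-p) * 2) ^ n := by rw [h1, mul_pow]; ring
        _ ≤ c * M⁻¹ * r ^ n := by rw [h2]; gcongr
    calc (W T : ℝ≥0∞) * (2 ^ n * τ (2 ^ n * T / (2 * C)))
        ≤ ((c * s ^ p * W t : ℝ≥0) : ℝ≥0∞) * (2 ^ n * τ (2 ^ n * T / (2 * C))) := by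
          gcongr
      _ = ((c * s ^ p * 2 ^ n : ℝ≥0) : ℝ≥0∞) * (W t * τ (2 ^ n * T / (2 * C))) := by
          push_cast; ring
      _ ≤ ((c * M⁻¹ * r ^ n : ℝ≥0) : ℝ≥0∞) * b := by gcongr
      _ = _ := by push_cast; rfl
  calc (W T : ℝ≥0∞) * σ T
      ≤ W T * ∑' n : ℕ, (2 : ℝ≥0∞) ^ n * τ (2 ^ n * T / (2 * C)) := by
        gcongr
        exact hστ T (by exact_mod_cast hT0)
    _ = ∑' n : ℕ, (W T : ℝ≥0∞) * (2 ^ n * τ (2 ^ n * T / (2 * C))) := ENNReal.tsum_mul_left.symm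
    _ ≤ ∑' n : ℕ, ((c * M⁻¹ : ℝ≥0) : ℝ≥0∞) * (r : ℝ≥0∞) ^ n * b := ENNReal.tsum_le_tsum hterm
    _ = ((c * M⁻¹ : ℝ≥0) : ℝ≥0∞) * (1 - (r : ℝ≥0∞))⁻¹ * b := by
        rw [ENNReal.tsum_mul_right, ENNReal.tsum_mul_left, ENNReal.tsum_geometric]
    _ ≤ ((1 - r : ℝ≥0) : ℝ≥0∞) * (1 - (r : ℝ≥0∞))⁻¹ * b := by gcongr
    _ ≤ 1 * b := by
        gcongr
        rw [ENNReal.coe_sub, ENNReal.coe_one]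
        exact ENNReal.mul_inv_le_one _
    _ = b := one_mul b

/-! ### Joint laws and the symmetrized kernel -/

theorem map_comp_pi {α β : Type*} [Fintype α] [Fintype β] {e : α → β}
    (he : Function.Injective e) (μ : β → Measure ℝ) [∀ b, IsProbabilityMeasure (μ b)] :
    (Measure.pi μ).map (fun y a => y (e a)) = Measure.pi (fun a => μ (e a)) := by
  have h : iIndepFun (fun (b : β) (y : β → ℝ) => y b) (Measure.pi μ) :=
    iIndepFun_pi (X := fun _ => id) fun _ => aemeasurable_id
  have h' := (iIndepFun_iff_map_fun_eq_pi_map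
    (fun a => (measurable_pi_apply (e a)).aemeasurable)).1 (h.precomp he)
  rw [h']
  congr 1
  funext a
  exact (measurePreserving_eval μ (e a)).map_eq

theorem map_eq_pi_of_iIndepFun {Ω α : Type*} [MeasurableSpace Ω] [Fintype α] {P : Measure Ω}
    [IsProbabilityMeasure P] {Y : α → Ω → ℝ} (hY : ∀ a, Measurable (Y a)) (h : iIndepFun Y P)
    {μ : α → Measure ℝ} (hμ : ∀ a, P.map (Y a) = μ a) :
    P.map (fun ω a => Y a ω) = Measure.pi μ := by
  rw [(iIndepFun_iff_map_fun_eq_pi_map fun a => (hY a).aemeasurable).1 h]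
  simp_rw [hμ]

theorem uStat_eq_multiSum {k : ℕ} {E Ω : Type*} [NormedAddCommGroup E] {G : (Fin k → ℕ) → (Fin k → ℝ) → E} {N : ℕ}
    (hG : ∀ i, G i ≠ 0 → ∀ a, i a < N) (X : Fin k → ℕ → Ω → ℝ) (ω : Ω) :
    uStat G X ω = multiSum (fun (i : Fin k → Fin N) => G fun a => i a)
      (fun a c => X a c ω) := by
  have hinj : Function.Injective fun (i : Fin k → Fin N) (a : Fin k) => (i a : ℕ) :=
    fun i j h => funext fun a => Fin.ext (congrFun h a)
  unfold uStat multiSum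
  rw [← finsum_eq_sum_of_fintype, ← finsum_mem_range (f := fun i : Fin k → ℕ =>
    G i (fun j => X j (i j) ω)) hinj, ← finsum_mem_univ]
  refine finsum_mem_inter_support_eq _ _ _ ?_
  ext i
  simp only [Set.univ_inter, Set.mem_inter_iff, Function.mem_support, iff_and_self]
  intro hi
  have hlt := hG i fun h => hi (by simp [h])
  exact ⟨fun a => ⟨i a, hlt a⟩, rfl⟩

theorem measurable_norm_multiSum {k : ℕ} {E ι : Type*} [NormedAddCommGroup E] [Fintype ι]
    {H : (Fin k → ι) → (Fin k → ℝ) → E} (hH : ∀ i, StronglyMeasurable (H i)) :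
    Measurable fun x : Fin k → ι → ℝ => ‖multiSum H x‖ := by
  refine StronglyMeasurable.measurable (StronglyMeasurable.norm ?_)
  unfold multiSum
  refine Finset.stronglyMeasurable_fun_sum _ fun i _ => ?_
  exact (hH i).comp_measurable (measurable_pi_lambda _ fun a =>
    (measurable_pi_apply (i a)).comp (measurable_pi_apply a))

section Kernel

variable {k : ℕ} {E : Type*} [NormedAddCommGroup E] [NormedSpace ℝ E]
  {F : (Fin k → ℕ) → (Fin k → ℝ) → E}

theorem symmetrize_perm (F : (Fin k → ℕ) → (Fin k → ℝ) → E) (π : Equiv.Perm (Fin k))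
    (i : Fin k → ℕ) (y : Fin k → ℝ) :
    symmetrize F (i ∘ π) (y ∘ π) = symmetrize F i y := by
  unfold symmetrize
  congr 1
  exact Equiv.sum_comp (Equiv.mulLeft π) fun σ : Equiv.Perm (Fin k) => F (i ∘ σ) (y ∘ σ)

theorem IsUKernel.symmetrize_eq_zero (hF : IsUKernel F) {i : Fin k → ℕ}
    (hi : ¬ Function.Injective i) : symmetrize F i = 0 := by
  obtain ⟨a, b, hab, hne⟩ := Function.not_injective_iff.1 hi
  have h : ∀ σ : Equiv.Perm (Fin k), F (i ∘ σ) = 0 := fun σ =>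
    hF.diagonalFree _ ⟨σ.symm a, σ.symm b, σ.symm.injective.ne hne, by simpa using hab⟩
  funext y
  simp [symmetrize, h]

theorem IsUKernel.stronglyMeasurable_symmetrize (hF : IsUKernel F) (i : Fin k → ℕ) :
    StronglyMeasurable (symmetrize F i) := by
  unfold symmetrize
  refine StronglyMeasurable.const_smul ?_ _
  refine Finset.stronglyMeasurable_fun_sum _ fun σ _ => ?_
  exact (hF.stronglyMeasurable _).comp_measurable
    (measurable_pi_lambda _ fun a => measurable_pi_apply _)

theorem IsUKernel.exists_bound (hF : IsUKernel F) :
    ∃ N, ∀ i, symmetrize F i ≠ 0 → ∀ a, i a < N := by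
  obtain ⟨u, hu⟩ := hF.finiteSupport.bddAbove
  refine ⟨Finset.univ.sup u + 1, fun i hi a => ?_⟩
  obtain ⟨σ, hσ⟩ : ∃ σ : Equiv.Perm (Fin k), F (i ∘ σ) ≠ 0 := by
    by_contra! h
    exact hi (funext fun y => by simp [symmetrize, h])
  have h1 : (i ∘ σ) (σ.symm a) ≤ u (σ.symm a) := hu hσ _
  simp only [Function.comp_apply, Equiv.apply_symm_apply] at h1
  exact Nat.lt_succ_of_le (h1.trans (Finset.le_sup (f := u) (Finset.mem_univ _)))

end Kernel

/-! ### Tail comparison and conclusion -/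

theorem AreIndepCopies.exists_tail_le (k : ℕ) (hk : 1 ≤ k) :
    ∃ C : ℝ, 0 < C ∧ ∀ (Ω : Type*) [MeasurableSpace Ω] (P : Measure Ω) [IsProbabilityMeasure P]
      (E : Type*) [NormedAddCommGroup E] [NormedSpace ℝ E]
      (F : (Fin k → ℕ) → (Fin k → ℝ) → E), IsUKernel F →
      ∀ (ξ : ℕ → Ω → ℝ) (X : Fin k → ℕ → Ω → ℝ), AreIndepCopies P ξ X → ∀ T : ℝ, 0 < T →
      P {ω | T ≤ ‖uStat (symmetrize F) (fun _ => ξ) ω‖} ≤ ∑' n : ℕ, (2 : ℝ≥0∞) ^ n *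
        P {ω | 2 ^ n * T / (2 * C) ≤ ‖uStat (symmetrize F) X ω‖} := by
  obtain ⟨C, hC⟩ := norm_multiSum_const_le k hk
  refine ⟨max C 1, by positivity, fun Ω _ P _ E _ _ F hF ξ X h T hT => ?_⟩
  obtain ⟨N, hN⟩ := hF.exists_bound
  obtain ⟨a, ha0, haC, hle⟩ := hC (Fin N)
  simp_rw [uStat_eq_multiSum hN]
  set H : (Fin k → Fin N) → (Fin k → ℝ) → E := fun i => symmetrize F fun a => i a with hH
  have hHm : Measurable fun x : Fin k → Fin N → ℝ => ‖multiSum H x‖ :=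
    measurable_norm_multiSum fun i => hF.stronglyMeasurable_symmetrize _
  have hH0 : ∀ i, ¬ Function.Injective i → H i = 0 := fun i hi =>
    hF.symmetrize_eq_zero fun h' => hi fun _ _ hab => h' (congrArg Fin.val hab)
  set μ : Fin N → Measure ℝ := fun c => P.map (ξ c) with hμ
  have : ∀ c, IsProbabilityMeasure (μ c) := fun c =>
    Measure.isProbabilityMeasure_map (h.measurable_seq c).aemeasurable
  have hμX : ∀ q : Fin k × Fin N, P.map (X q.1 q.2) = μ q.2 := fun q =>
    ((h.identDistrib q.1).comp (measurable_pi_apply (q.2 : ℕ))).map_eq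
  -- `ξ` and `X` may be dependent, so the comparison takes place on a product space with `k + 1`
  -- independent rows, `none` standing for `ξ`.
  set ν : Measure (Option (Fin k) × Fin N → ℝ) := Measure.pi fun q => μ q.2 with hν
  have hlaw1 : P.map (fun ω (c : Fin N) => ξ c ω) =
      ν.map (fun y c => y (none, c)) := by
    rw [hν, map_comp_pi (e := fun c : Fin N => (none, c)) (fun _ _ h => (Prod.ext_iff.1 h).2)]
    exact map_eq_pi_of_iIndepFun (Y := fun c : Fin N => ξ c) (fun c => h.measurable_seq c)
      (h.indep_seq.precomp (g := fun c : Fin N => (c : ℕ)) Fin.val_injective) fun c => rfl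
  -- Each `none` entry is used at most once, so the relabelling is injective; it preserves columns,
  -- hence marginals.
  have hlaw2 : ∀ b : Fin N → Option (Fin k), P.map (fun ω (q : Fin k × Fin N) => X q.1 q.2 ω) =
      ν.map (fun y q => y (if b q.2 = some q.1 then none else some q.1, q.2)) := by
    intro b
    rw [hν, map_comp_pi (e := fun q : Fin k × Fin N =>
      ((if b q.2 = some q.1 then none else some q.1), q.2))]
    · refine map_eq_pi_of_iIndepFun (Y := fun q : Fin k × Fin N => X q.1 q.2)
        (fun q => h.measurable_rows q.1 q.2)
        (h.indep_rows.precomp (g := fun q : Fin k × Fin N => (q.1, (q.2 : ℕ))) ?_) hμX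
      rintro ⟨a, c⟩ ⟨a', c'⟩ h
      simpa [Fin.ext_iff] using h
    · rintro ⟨a, c⟩ ⟨a', c'⟩ h
      simp only [Prod.mk.injEq] at h ⊢
      obtain ⟨h1, rfl⟩ := h
      refine ⟨?_, rfl⟩
      split_ifs at h1 with h2 h3 h3
      · exact Option.some.inj (h2.symm.trans h3)
      · exact Option.some.inj h1
  have hm1 : ∀ u : ℝ, MeasurableSet {v : Fin N → ℝ | u ≤ ‖multiSum H fun _ => v‖} := fun u =>
    measurableSet_le measurable_const (hHm.comp (measurable_pi_lambda _ fun _ => measurable_id))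
  have hm2 : ∀ u : ℝ, MeasurableSet
      {v : Fin k × Fin N → ℝ | u ≤ ‖multiSum H fun j c => v (j, c)‖} := fun u =>
    measurableSet_le measurable_const (hHm.comp (by fun_prop))
  have hξ := h.measurable_seq
  have hX := h.measurable_rows
  have e1 : P {ω | T ≤ ‖multiSum H fun _ c => ξ c ω‖} =
      ν {y | T ≤ ‖multiSum H fun _ c => y (none, c)‖} := by
    have := congrArg (fun m => m {v : Fin N → ℝ | T ≤ ‖multiSum H fun _ => v‖}) hlaw1
    rwa [Measure.map_apply (by fun_prop) (hm1 T), Measure.map_apply (by fun_prop) (hm1 T)] at this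
  rw [e1]
  set η : (Fin N → Option (Fin k)) → (Option (Fin k) × Fin N → ℝ) → ℝ := fun b y =>
    ‖multiSum H fun j c => if b c = some j then y (none, c) else y (some j, c)‖ with hη
  have hηm : ∀ b, Measurable (η b) := by
    intro b
    refine hHm.comp (measurable_pi_lambda _ fun j => measurable_pi_lambda _ fun c => ?_)
    split_ifs <;> exact measurable_pi_apply _
  have hdom : ∀ y : Option (Fin k) × Fin N → ℝ,
      ‖multiSum H fun _ c => y (none, c)‖ ≤ ∑ b, a b * η b y :=
    fun y => hle E H hH0 (fun j c => y (some j, c)) fun c => y (none, c)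
  have htail : ∀ b u, ν {y | u ≤ η b y} ≤ P {ω | u ≤ ‖multiSum H fun j c => X j c ω‖} := by
    intro b u
    have := congrArg (fun m => m {v : Fin k × Fin N → ℝ | u ≤ ‖multiSum H fun j c => v (j, c)‖})
      (hlaw2 b)
    rw [Measure.map_apply (by fun_prop) (hm2 u), Measure.map_apply (by fun_prop) (hm2 u)] at this
    refine le_of_eq (Eq.trans ?_ this.symm)
    congr 1
    ext y
    have hy : ∀ (j : Fin k) (c : Fin N), y (if b c = some j then none else some j, c) =
        if b c = some j then y (none, c) else y (some j, c) := by
      intro j c; split_ifs <;> rfl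
    simp only [Set.mem_preimage, Set.mem_ofPred_eq, hη, hy]
  exact measure_le_of_le_sum (by positivity) ha0 (haC.trans (le_max_left _ _)) hηm hdom
    (τ := fun u => P {ω | u ≤ ‖multiSum H fun j c => X j c ω‖}) htail hT

theorem AreInterchangeable.exists_tail_le (k : ℕ) (hk : 1 ≤ k) :
    ∃ C : ℝ, 0 < C ∧ ∀ (Ω : Type*) [MeasurableSpace Ω] (P : Measure Ω) [IsProbabilityMeasure P]
      (E : Type*) [NormedAddCommGroup E] [NormedSpace ℝ E]
      (F : (Fin k → ℕ) → (Fin k → ℝ) → E), IsUKernel F →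
      ∀ (ξ : ℕ → Ω → ℝ) (X : Fin k → ℕ → Ω → ℝ), AreInterchangeable P ξ X → ∀ T : ℝ, 0 < T →
      P {ω | T ≤ ‖uStat (symmetrize F) X ω‖} ≤ ∑' n : ℕ, (2 : ℝ≥0∞) ^ n *
        P {ω | 2 ^ n * T / (2 * C) ≤ ‖uStat (symmetrize F) (fun _ => ξ) ω‖} := by
  obtain ⟨C, hC⟩ := norm_multiSum_le_const k hk
  refine ⟨max C 1, by positivity, fun Ω _ P _ E _ _ F hF ξ X h T hT => ?_⟩
  obtain ⟨N, hN⟩ := hF.exists_bound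
  obtain ⟨a, ha0, haC, hle⟩ := hC (Fin N)
  simp_rw [uStat_eq_multiSum hN]
  set H : (Fin k → Fin N) → (Fin k → ℝ) → E := fun i => symmetrize F fun a => i a with hH
  have hHm : Measurable fun x : Fin k → Fin N → ℝ => ‖multiSum H x‖ :=
    measurable_norm_multiSum fun i => hF.stronglyMeasurable_symmetrize _
  have hH0 : ∀ i, ¬ Function.Injective i → H i = 0 := fun i hi =>
    hF.symmetrize_eq_zero fun h' => hi fun _ _ hab => h' (congrArg Fin.val hab)
  have hξ := h.measurable_seq
  have hX := h.measurable_rows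
  -- With independent columns, a row picked one entry per column has the law of `ξ`, whatever the
  -- dependence within columns.
  have hrow : ∀ b : Fin N → Fin k, P.map (fun ω (c : Fin N) => X (b c) c ω) =
      Measure.pi fun c : Fin N => P.map (ξ c) := by
    intro b
    refine map_eq_pi_of_iIndepFun (fun c => hX _ _) ?_ fun c =>
      ((h.identDistrib (b c)).comp (measurable_pi_apply (c : ℕ))).map_eq
    exact (h.indep_columns.precomp (g := fun c : Fin N => (c : ℕ)) Fin.val_injective).comp (fun c v => v (b c))
      fun c => measurable_pi_apply _
  have hξlaw : P.map (fun ω (c : Fin N) => ξ c ω) = Measure.pi fun c : Fin N => P.map (ξ c) := by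
    rw [← hrow fun _ => ⟨0, hk⟩]
    exact ((h.identDistrib ⟨0, hk⟩).comp (u := fun (v : ℕ → ℝ) (c : Fin N) => v c)
      (by fun_prop)).map_eq.symm
  have hm : ∀ u : ℝ, MeasurableSet {v : Fin N → ℝ | u ≤ ‖multiSum H fun _ => v‖} := fun u =>
    measurableSet_le measurable_const (hHm.comp (measurable_pi_lambda _ fun _ => measurable_id))
  refine measure_le_of_le_sum (η := fun b ω => ‖multiSum H fun _ c => X (b c) c ω‖)
    (by positivity) ha0 (haC.trans (le_max_left _ _)) (fun b => hHm.comp (by fun_prop))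
    (fun ω => hle E H hH0 (fun σ i y => symmetrize_perm F σ (fun a => (i a : ℕ)) y) fun j c => X j c ω)
    (τ := fun u => P {ω | u ≤ ‖multiSum H fun _ c => ξ c ω‖}) (fun b u => ?_) hT
  have := congrArg (fun m => m {v : Fin N → ℝ | u ≤ ‖multiSum H fun _ => v‖})
    ((hrow b).trans hξlaw.symm)
  rw [Measure.map_apply (by fun_prop) (hm u), Measure.map_apply (by fun_prop) (hm u)] at this
  exact this.le

theorem limsupTail_anti {Ω E : Type*} [MeasurableSpace Ω] (P : Measure Ω)
    [NormedAddCommGroup E] (W : ℝ≥0 → ℝ≥0) (Z : Ω → E) : Antitone (limsupTail P W Z) := by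
  intro a b hab
  refine limsup_le_limsup (Eventually.of_forall fun t => ?_)
  dsimp only
  gcongr

end UStatDecoupling

theorem mainTheorem8 (k : ℕ) (hk : 1 ≤ k) (p : ℝ) (hp : 1 < p) (c : ℝ≥0) (hc : 0 < c) :
    ∃ C : ℝ≥0, 0 < C ∧
      ∀ (W : ℝ≥0 → ℝ≥0), Monotone W →
        (∀ s t : ℝ≥0, 0 < s → s < 1 → 0 < t → W (s * t) ≤ c * s ^ p * W t) →
      ∀ (Ω : Type*) [MeasurableSpace Ω] (P : Measure Ω) [IsProbabilityMeasure P]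
        (E : Type*) [NormedAddCommGroup E] [NormedSpace ℝ E] [CompleteSpace E]
        (F : (Fin k → ℕ) → (Fin k → ℝ) → E), UStatDecoupling.IsUKernel F →
      ∀ (ξ : ℕ → Ω → ℝ) (X : Fin k → ℕ → Ω → ℝ),
        (UStatDecoupling.AreIndepCopies P ξ X →
          UStatDecoupling.limsupTail P W
              (UStatDecoupling.uStat (UStatDecoupling.symmetrize F) (fun _ => ξ)) 1 ≤
            UStatDecoupling.limsupTail P W
              (UStatDecoupling.uStat (UStatDecoupling.symmetrize F) X) C) ∧
        (UStatDecoupling.AreInterchangeable P ξ X →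
          UStatDecoupling.limsupTail P W
              (UStatDecoupling.uStat (UStatDecoupling.symmetrize F) X) 1 ≤
            UStatDecoupling.limsupTail P W
              (UStatDecoupling.uStat (UStatDecoupling.symmetrize F) (fun _ => ξ)) C) := by
  obtain ⟨C₁, hC₁, h₁⟩ := UStatDecoupling.AreIndepCopies.exists_tail_le k hk
  obtain ⟨C₂, hC₂, h₂⟩ := UStatDecoupling.AreInterchangeable.exists_tail_le k hk
  obtain ⟨D₁, hD₁, hlim₁⟩ := UStatDecoupling.exists_limsup_le hp c hC₁
  obtain ⟨D₂, hD₂, hlim₂⟩ := UStatDecoupling.exists_limsup_le hp c hC₂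
  refine ⟨min D₁ D₂, lt_min hD₁ hD₂, fun W _ hW Ω _ P _ E _ _ _ F hF ξ X =>
    ⟨fun h => ?_, fun h => ?_⟩⟩
  · refine le_trans ?_ (UStatDecoupling.limsupTail_anti P W _ (min_le_left D₁ D₂))
    simpa [UStatDecoupling.limsupTail] using hlim₁ W hW _
      (fun u => P {ω | u ≤ ‖UStatDecoupling.uStat (UStatDecoupling.symmetrize F) X ω‖})
      (h₁ Ω P E F hF ξ X h)
  · refine le_trans ?_ (UStatDecoupling.limsupTail_anti P W _ (min_le_right D₁ D₂))
    simpa [UStatDecoupling.limsupTail] using hlim₂ W hW _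
      (fun u => P {ω | u ≤ ‖UStatDecoupling.uStat (UStatDecoupling.symmetrize F) (fun _ => ξ) ω‖})
      (h₂ Ω P E F hF ξ X h)
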